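/- Let $\mathcal{H}_\flat(\mathbb{C})$ be the Fock space, i.e. the Hilbert space of entire functions $f:\mathbb{C}\to\mathbb{C}$ with $\|f\|_\flat^2=\langle f,f\rangle_\flat<\infty$, where \[ \langle f,g\rangle_\flat:=\frac1\pi\int_{\mathbb{C}} f(w)\overline{g(w)}\,e^{-|w|^2}\,dw \] ($dw$ is Lebesgue measure on $\mathbb{C}\cong\mathbb{R}^2$). Let $\Gamma_\flat^\circ$ be the semigroup of all complex matrices \[ \gamma=\begin{bmatrix}1&a&b\\0&c&d\\0&0&1\end{bmatrix},\qquad a,b,d\in\mathbb{C},\quad c\in\mathbb{C}\setminus\{0\},\quad |\det\gamma|=|c|<1, \] and for such $\gamma$ put $(\tau_\flat(\gamma)f)(w):=e^{dw-b}f(cw-a)$. **Theorem.** For every $\gamma\in\Gamma_\flat^\circ$ as above, $\tau_\flat(\gamma)$ maps $\mathcal{H}_\flat(\mathbb{C})$ into itself and is a bounded operator of trace class on it, i.e. $\sum_k\bigl\langle\sqrt{\tau_\flat(\gamma)^\dagger\tau_\flat(\gamma)}\,v_k,v_k\bigr\rangle_\flat<\infty$ for every orthonormal basis $\{v_k\}$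 of $\mathcal{H}_\flat(\mathbb{C})$. For every orthonormal basis $\{v_k\}$, its trace is \[ \operatorname{Tr}(\tau_\flat(\gamma))=\sum_k\langle\tau_\flat(\gamma)v_k,v_k\rangle_\flat=\frac{\exp\Bigl(-\dfrac{ad+b(1-c)}{1-c}\Bigr)}{1-c}. \] -/

import Mathlib

open MeasureTheory Filter Topology
open scoped ComplexConjugate

noncomputable section

namespace Fock

/-- The entire functions `f` with `∫ |f(w)|² e^{-|w|²} dw < ∞`, as a space of functions. -/
def fockSubmodule : Submodule ℂ (ℂ → ℂ) where
  carrier := {f | Differentiable ℂ f ∧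
    Integrable (fun w : ℂ => ‖f w‖ ^ 2 * Real.exp (-‖w‖ ^ 2)) volume}
  zero_mem' := by
    refine ⟨differentiable_const 0, ?_⟩
    simp
  add_mem' := by
    rintro f g ⟨hf, hf2⟩ ⟨hg, hg2⟩
    refine ⟨hf.add hg, ?_⟩
    refine ((hf2.add hg2).const_mul 2).mono' ?_ (ae_of_all _ fun w => ?_)
    · exact ((((hf.continuous.add hg.continuous).norm).pow 2).mul
        (by fun_prop)).aestronglyMeasurable
    · have h1 : ‖f w + g w‖ ^ 2 ≤ 2 * (‖f w‖ ^ 2 + ‖g w‖ ^ 2) := by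
        have h := norm_add_le (f w) (g w)
        have h0 := norm_nonneg (f w + g w)
        nlinarith [sq_nonneg (‖f w‖ - ‖g w‖)]
      rw [Real.norm_of_nonneg (by positivity)]
      simp only [Pi.add_apply]
      calc _ ≤ 2 * (‖f w‖ ^ 2 + ‖g w‖ ^ 2) * Real.exp (-‖w‖ ^ 2) := by gcongr
        _ = _ := by ring
  smul_mem' := by
    rintro c f ⟨hf, hf2⟩
    refine ⟨hf.const_smul c, ?_⟩
    refine (hf2.const_mul (‖c‖ ^ 2)).congr (ae_of_all _ fun w => ?_)
    simp only [Pi.smul_apply, norm_smul]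
    ring

end Fock

/-- The Fock space: entire functions, square integrable for the weight `e^{-|w|²}`.
(A separate type, since its topology is the norm topology and not that of pointwise
convergence.) -/
def FockSpace : Type := Fock.fockSubmodule

namespace FockSpace

instance : AddCommGroup FockSpace := inferInstanceAs (AddCommGroup Fock.fockSubmodule)

instance : Module ℂ FockSpace := inferInstanceAs (Module ℂ Fock.fockSubmodule)

instance : CoeFun FockSpace (fun _ => ℂ → ℂ) := ⟨fun f => f.1⟩

/-- An entire function with finite norm, as an element of the Fock space. -/
def mk (f : ℂ → ℂ) (hf : Differentiable ℂ f)
    (hf2 : Integrable (fun w : ℂ => ‖f w‖ ^ 2 * Real.exp (-‖w‖ ^ 2)) volume) : FockSpace :=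
  ⟨f, hf, hf2⟩

@[simp] theorem mk_apply (f : ℂ → ℂ) (hf : Differentiable ℂ f)
    (hf2 : Integrable (fun w : ℂ => ‖f w‖ ^ 2 * Real.exp (-‖w‖ ^ 2)) volume) (w : ℂ) :
    mk f hf hf2 w = f w := rfl

theorem ext {f g : FockSpace} (h : ∀ w, f w = g w) : f = g := Subtype.ext (funext h)

theorem differentiable (f : FockSpace) : Differentiable ℂ (f : ℂ → ℂ) := f.2.1

theorem integrable (f : FockSpace) :
    Integrable (fun w : ℂ => ‖f w‖ ^ 2 * Real.exp (-‖w‖ ^ 2)) volume := f.2.2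

@[simp] theorem add_apply (f g : FockSpace) (w : ℂ) : (f + g) w = f w + g w := rfl

@[simp] theorem sub_apply (f g : FockSpace) (w : ℂ) : (f - g) w = f w - g w := rfl

@[simp] theorem smul_apply (c : ℂ) (f : FockSpace) (w : ℂ) : (c • f) w = c * f w := rfl

@[simp] theorem zero_apply (w : ℂ) : (0 : FockSpace) w = 0 := rfl

theorem integrable_inner (f g : FockSpace) :
    Integrable (fun w : ℂ => conj (f w) * g w * (Real.exp (-‖w‖ ^ 2) : ℂ)) volume := by
  have hf := f.differentiable.continuous
  have hg := g.differentiable.continuous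
  refine (f.integrable.add g.integrable).mono' ?_ (ae_of_all _ fun w => ?_)
  · exact Continuous.aestronglyMeasurable (by fun_prop)
  · rw [norm_mul, norm_mul, RCLike.norm_conj, Complex.norm_real,
      Real.norm_of_nonneg (Real.exp_nonneg _)]
    simp only [Pi.add_apply]
    rw [← add_mul]
    gcongr
    nlinarith [sq_nonneg (‖f w‖ - ‖g w‖), sq_nonneg (‖f w‖), sq_nonneg (‖g w‖)]

/-- `(1/π) ∫ conj (f w) g(w) e^{-|w|²} dw`; Mathlib's inner products are conjugate linear in the
first variable. -/
def fockInner (f g : FockSpace) : ℂ :=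
  (1 / (Real.pi : ℂ)) * ∫ w : ℂ, conj (f w) * g w * (Real.exp (-‖w‖ ^ 2) : ℂ)

theorem fockInner_self (f : FockSpace) :
    fockInner f f = ((1 / Real.pi * ∫ w : ℂ, ‖f w‖ ^ 2 * Real.exp (-‖w‖ ^ 2) : ℝ) : ℂ) := by
  rw [fockInner, Complex.ofReal_mul, ← integral_complex_ofReal]
  push_cast
  congr 2
  funext w
  rw [Complex.conj_mul']

theorem fockInner_definite (f : FockSpace) (h : fockInner f f = 0) : f = 0 := by
  rw [fockInner_self, Complex.ofReal_eq_zero, mul_eq_zero, or_iff_right (by positivity),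
    integral_eq_zero_iff_of_nonneg (fun w => by simp only [Pi.zero_apply]; positivity)
      f.integrable] at h
  have hf := f.differentiable.continuous
  have h2 := (Continuous.ae_eq_iff_eq volume (by fun_prop) continuous_zero).1 h
  refine ext fun w => ?_
  have := congrFun h2 w
  simpa [Real.exp_ne_zero] using this

abbrev innerCore : InnerProductSpace.Core ℂ FockSpace where
  inner := fockInner
  conj_inner_symm f g := by
    simp only [fockInner, map_mul, ← integral_conj]
    congr 1
    · simp
    · congr 1
      funext w
      simp only [Complex.conj_conj, Complex.conj_ofReal, mul_comm]
  re_inner_nonneg f := by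
    rw [fockInner_self]
    simp only [RCLike.re_to_complex, Complex.ofReal_re]
    have : 0 ≤ ∫ w : ℂ, ‖f w‖ ^ 2 * Real.exp (-‖w‖ ^ 2) :=
      integral_nonneg fun w => by positivity
    positivity
  add_left f g h := by
    simp only [fockInner]
    rw [← mul_add, ← integral_add (integrable_inner f h) (integrable_inner g h)]
    congr 2
    funext w
    simp only [add_apply, map_add]
    ring
  smul_left f g c := by
    simp only [fockInner]
    rw [mul_left_comm, ← integral_const_mul (conj c)]
    congr 2
    funext w
    simp only [smul_apply, map_mul]
    ring
  definite := fockInner_definite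

instance : NormedAddCommGroup FockSpace := innerCore.toNormedAddCommGroup

instance : InnerProductSpace ℂ FockSpace := InnerProductSpace.ofCore innerCore.toCore

theorem inner_def (f g : FockSpace) : inner ℂ f g =
    (1 / (Real.pi : ℂ)) * ∫ w : ℂ, conj (f w) * g w * (Real.exp (-‖w‖ ^ 2) : ℂ) := rfl

theorem norm_sq_eq (f : FockSpace) :
    ‖f‖ ^ 2 = 1 / Real.pi * ∫ w : ℂ, ‖f w‖ ^ 2 * Real.exp (-‖w‖ ^ 2) := by
  have h : (inner ℂ f f : ℂ) = _ := fockInner_self f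
  rw [inner_self_eq_norm_sq_to_K] at h
  exact Complex.ofReal_injective (by rw [← h]; push_cast; rfl)

end FockSpace

namespace Fock

theorem enorm_le_circle {g : ℂ → ℂ} (hg : Differentiable ℂ g) (z : ℂ) (r : ℝ) :
    ENNReal.ofReal (2 * Real.pi) * ‖g z‖ₑ ≤
      ∫⁻ t in Set.Ioo (-Real.pi) Real.pi, ‖g (z + Complex.polarCoord.symm (r, t))‖ₑ := by
  have h1 : Real.circleAverage g z r = g z := hg.diffContOnCl.circleAverage
  rw [Real.circleAverage_def] at h1
  have hper : Function.Periodic (fun t => g (circleMap z r t)) (2 * Real.pi) :=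
    fun t => by simp only [periodic_circleMap z r t]
  have h2 := hper.intervalIntegral_add_eq 0 (-Real.pi)
  rw [zero_add, show -Real.pi + 2 * Real.pi = Real.pi by ring] at h2
  have hpi := Real.pi_pos
  have h3 : (2 * Real.pi) • g z = ∫ t in Set.Ioo (-Real.pi) Real.pi, g (circleMap z r t) := by
    rw [← h1, h2, smul_smul, mul_inv_cancel₀ (by positivity), one_smul,
      intervalIntegral.integral_of_le (by linarith), integral_Ioc_eq_integral_Ioo]
  have h4 : ENNReal.ofReal (2 * Real.pi) * ‖g z‖ₑ = ‖(2 * Real.pi) • g z‖ₑ := by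
    rw [enorm_smul, Real.enorm_eq_ofReal (by positivity)]
  rw [h4, h3]
  refine (enorm_integral_le_lintegral_enorm _).trans_eq ?_
  congr 1
  funext t
  rw [Complex.polarCoord_symm_apply, circleMap, Complex.exp_mul_I]
  push_cast
  rfl

theorem enorm_le_ball {g : ℂ → ℂ} (hg : Differentiable ℂ g) (z : ℂ) :
    ENNReal.ofReal Real.pi * ‖g z‖ₑ ≤ ∫⁻ w in Metric.ball z 1, ‖g w‖ₑ := by
  have hgc := hg.continuous
  have e1 : ∫⁻ w in Metric.ball z 1, ‖g w‖ₑ =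
      ∫⁻ w : ℂ, (Metric.ball z 1).indicator (fun w => ‖g w‖ₑ) (z + w) := by
    rw [lintegral_add_left_eq_self (fun w => (Metric.ball z 1).indicator (fun w => ‖g w‖ₑ) w) z,
      lintegral_indicator measurableSet_ball]
  have hmeas : Measurable fun w : ℂ => (Metric.ball z 1).indicator (fun w => ‖g w‖ₑ) (z + w) :=
    (hgc.enorm.measurable.indicator measurableSet_ball).comp (measurable_const_add z)
  have hm2 : Measurable fun p : ℝ × ℝ => ENNReal.ofReal p.1 •
      (Metric.ball z 1).indicator (fun w => ‖g w‖ₑ) (z + Complex.polarCoord.symm p) := by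
    have : Measurable fun p : ℝ × ℝ => Complex.polarCoord.symm p := by
      have : (fun p : ℝ × ℝ => Complex.polarCoord.symm p) =
          fun p => (p.1 : ℂ) * ((Real.cos p.2 : ℂ) + (Real.sin p.2 : ℂ) * Complex.I) := by
        funext p
        exact Complex.polarCoord_symm_apply p
      rw [this]
      exact Continuous.measurable (by fun_prop)
    exact (ENNReal.measurable_ofReal.comp measurable_fst).smul (hmeas.comp this)
  rw [e1, ← Complex.lintegral_comp_polarCoord_symm, polarCoord_target,
    Measure.volume_eq_prod, ← Measure.prod_restrict, lintegral_prod _ hm2.aemeasurable]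
  have hpi := Real.pi_pos
  have e2 : ENNReal.ofReal Real.pi * ‖g z‖ₑ = ∫⁻ r in Set.Ioo (0 : ℝ) 1,
      ENNReal.ofReal r * (ENNReal.ofReal (2 * Real.pi) * ‖g z‖ₑ) := by
    rw [lintegral_mul_const _ ENNReal.measurable_ofReal, ← mul_assoc,
      ← ofReal_integral_eq_lintegral_ofReal, ← integral_Ioc_eq_integral_Ioo,
      ← intervalIntegral.integral_of_le zero_le_one, integral_id,
      ← ENNReal.ofReal_mul (by norm_num)]
    · congr 2
      ring
    · exact (continuous_id.integrableOn_Icc (a := (0 : ℝ)) (b := 1)).mono_set Set.Ioo_subset_Icc_self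
    · exact (ae_restrict_iff' measurableSet_Ioo).2 (ae_of_all _ fun r hr => hr.1.le)
  rw [e2]
  refine le_trans ?_ (lintegral_mono_set (s := Set.Ioo (0 : ℝ) 1) fun r hr => hr.1)
  refine setLIntegral_mono' measurableSet_Ioo fun r hr => ?_
  simp only [smul_eq_mul]
  rw [lintegral_const_mul' _ _ ENNReal.ofReal_ne_top]
  gcongr
  refine (enorm_le_circle hg z r).trans_eq ?_
  refine lintegral_congr fun t => ?_
  rw [Set.indicator_of_mem]
  rw [Metric.mem_ball, dist_eq_norm, add_sub_cancel_left, Complex.norm_polarCoord_symm,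
    abs_of_pos hr.1]
  exact hr.2

end Fock

namespace FockSpace

/-- Point evaluations are bounded, locally uniformly. -/
theorem norm_apply_le (f : FockSpace) (z : ℂ) :
    ‖f z‖ ≤ Real.exp ((‖z‖ + 1) ^ 2 / 2) * ‖f‖ := by
  have hf := f.differentiable
  have hpi := Real.pi_pos
  have h1 := Fock.enorm_le_ball (g := fun w => f w ^ 2) (hf.pow 2) z
  have h2 : ∫⁻ w in Metric.ball z 1, ‖f w ^ 2‖ₑ ≤
      ENNReal.ofReal (Real.exp ((‖z‖ + 1) ^ 2) * (Real.pi * ‖f‖ ^ 2)) := by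
    rw [norm_sq_eq, ← mul_assoc Real.pi, mul_one_div_cancel hpi.ne', one_mul,
      ← integral_const_mul, ofReal_integral_eq_lintegral_ofReal (f.integrable.const_mul _)
        (ae_of_all _ fun w => by simp only [Pi.zero_apply]; positivity)]
    refine le_trans (setLIntegral_mono' measurableSet_ball fun w hw => ?_)
      (setLIntegral_le_lintegral (Metric.ball z 1) _)
    rw [← ofReal_norm, norm_pow]
    refine ENNReal.ofReal_le_ofReal ?_
    have hw' : ‖w‖ ≤ ‖z‖ + 1 := by
      have : ‖w - z‖ < 1 := by simpa [dist_eq_norm] using hw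
      have := norm_add_le z (w - z)
      rw [add_sub_cancel] at this
      linarith
    have h3 : 1 ≤ Real.exp ((‖z‖ + 1) ^ 2) * Real.exp (-‖w‖ ^ 2) := by
      rw [← Real.exp_add, Real.one_le_exp_iff]
      nlinarith [norm_nonneg w]
    nlinarith [sq_nonneg ‖f w‖]
  have h3 := h1.trans h2
  rw [← ofReal_norm, ← ENNReal.ofReal_mul hpi.le,
    ENNReal.ofReal_le_ofReal_iff (by positivity), norm_pow] at h3
  have h4 : ‖f z‖ ^ 2 ≤ (Real.exp ((‖z‖ + 1) ^ 2 / 2) * ‖f‖) ^ 2 := by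
    rw [mul_pow, ← Real.exp_nat_mul]
    push_cast
    rw [mul_div_cancel₀ _ (two_ne_zero)]
    have : Real.pi * ‖f z‖ ^ 2 ≤ Real.pi * (Real.exp ((‖z‖ + 1) ^ 2) * ‖f‖ ^ 2) := by linarith
    exact le_of_mul_le_mul_left this hpi
  exact le_of_sq_le_sq h4 (by positivity)

/-- `w ↦ f(w) e^{-|w|²/2}`. -/
def weighted (f : ℂ → ℂ) (w : ℂ) : ℂ := f w * (Real.exp (-‖w‖ ^ 2 / 2) : ℂ)

theorem norm_weighted_sq (f : ℂ → ℂ) (w : ℂ) :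
    ‖weighted f w‖ ^ 2 = ‖f w‖ ^ 2 * Real.exp (-‖w‖ ^ 2) := by
  rw [weighted, norm_mul, Complex.norm_real, Real.norm_of_nonneg (Real.exp_nonneg _), mul_pow,
    ← Real.exp_nat_mul]
  congr 2
  push_cast
  ring

theorem memLp_weighted_iff {f : ℂ → ℂ} (hf : Continuous f) : MemLp (weighted f) 2 volume ↔
    Integrable (fun w : ℂ => ‖f w‖ ^ 2 * Real.exp (-‖w‖ ^ 2)) volume := by
  have : AEStronglyMeasurable (weighted f) volume := by
    unfold weighted
    exact Continuous.aestronglyMeasurable (by fun_prop)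
  rw [memLp_two_iff_integrable_sq_norm this]
  simp only [norm_weighted_sq]

theorem memLp_weighted (f : FockSpace) : MemLp (weighted f) 2 volume :=
  (memLp_weighted_iff f.differentiable.continuous).2 f.integrable

theorem norm_toLp_weighted (f : FockSpace) :
    ‖(memLp_weighted f).toLp (weighted f)‖ ^ 2 = Real.pi * ‖f‖ ^ 2 := by
  rw [norm_sq_eq, ← mul_assoc, mul_one_div_cancel Real.pi_ne_zero, one_mul,
    ← inner_self_eq_norm_sq (𝕜 := ℂ), L2.inner_def, ← integral_re (L2.integrable_inner _ _)]
  refine integral_congr_ae ?_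
  filter_upwards [(memLp_weighted f).coeFn_toLp] with w hw
  rw [hw, inner_self_eq_norm_sq, norm_weighted_sq]

theorem norm_toLp_weighted_sub (f g : FockSpace) :
    ‖(memLp_weighted f).toLp (weighted f) - (memLp_weighted g).toLp (weighted g)‖ =
      √Real.pi * ‖f - g‖ := by
  have h : (memLp_weighted f).toLp (weighted f) - (memLp_weighted g).toLp (weighted g) =
      (memLp_weighted (f - g)).toLp (weighted (f - g : FockSpace)) := by
    rw [← MemLp.toLp_sub]
    congr 1
    funext w
    simp [weighted, sub_mul]
  have h2 := norm_toLp_weighted (f - g)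
  rw [h, ← sq_eq_sq₀ (by positivity) (by positivity), h2, mul_pow, Real.sq_sqrt Real.pi_pos.le]

instance : CompleteSpace FockSpace := by
  refine Metric.complete_of_cauchySeq_tendsto fun u hu => ?_
  have hpi := Real.pi_pos
  set T : FockSpace → Lp ℂ 2 (volume : Measure ℂ) :=
    fun f => (memLp_weighted f).toLp (weighted f) with hT
  have hTd : ∀ f g, dist (T f) (T g) = √Real.pi * dist f g := fun f g => by
    rw [dist_eq_norm, dist_eq_norm, hT]
    exact norm_toLp_weighted_sub f g
  -- the limit in the Lebesgue space
  have hTu : CauchySeq fun n => T (u n) := by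
    rw [Metric.cauchySeq_iff'] at hu ⊢
    intro ε hε
    obtain ⟨N, hN⟩ := hu (ε / √Real.pi) (by positivity)
    refine ⟨N, fun n hn => ?_⟩
    rw [hTd]
    have := hN n hn
    rwa [lt_div_iff₀ (by positivity), mul_comm] at this
  obtain ⟨G, hG⟩ := cauchySeq_tendsto_of_complete hTu
  -- the locally uniform limit
  have hunif : ∀ R : ℝ, UniformCauchySeqOn (fun n => (u n : ℂ → ℂ)) atTop
      (Metric.closedBall 0 R) := by
    intro R
    rw [Metric.uniformCauchySeqOn_iff]
    intro ε hε
    rw [Metric.cauchySeq_iff] at hu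
    obtain ⟨N, hN⟩ := hu (ε / Real.exp ((R + 1) ^ 2 / 2)) (by positivity)
    refine ⟨N, fun m hm n hn z hz => ?_⟩
    have hz' : ‖z‖ ≤ R := by simpa using hz
    have h1 := hN m hm n hn
    rw [lt_div_iff₀ (by positivity), dist_eq_norm] at h1
    have h2 := norm_apply_le (u m - u n) z
    rw [sub_apply] at h2
    rw [dist_eq_norm]
    refine lt_of_le_of_lt h2 (lt_of_le_of_lt ?_ h1)
    rw [mul_comm]
    have := norm_nonneg z
    gcongr
  have hpt : ∀ z : ℂ, CauchySeq fun n => (u n) z := fun z =>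
    (hunif ‖z‖).cauchySeq (by simp)
  choose F hF using fun z => cauchySeq_tendsto_of_complete (hpt z)
  have hloc : TendstoLocallyUniformlyOn (fun n => (u n : ℂ → ℂ)) F atTop Set.univ := by
    rw [tendstoLocallyUniformlyOn_iff_forall_isCompact isOpen_univ]
    intro K _ hK
    obtain ⟨R, hR⟩ := hK.isBounded.subset_closedBall 0
    exact ((hunif R).tendstoUniformlyOn_of_tendsto fun z _ => hF z).mono hR
  have hFd : Differentiable ℂ F := by
    rw [← differentiableOn_univ]
    exact hloc.differentiableOn
      (Eventually.of_forall fun n => (u n).differentiable.differentiableOn) isOpen_univ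
  have hFG : weighted F =ᵐ[volume] G := by
    obtain ⟨ns, hns, hns2⟩ := (tendstoInMeasure_of_tendsto_Lp hG).exists_seq_tendsto_ae
    have hall : ∀ᵐ w : ℂ, ∀ n, T (u n) w = weighted (u n) w :=
      ae_all_iff.2 fun n => (memLp_weighted (u n)).coeFn_toLp
    filter_upwards [hns2, hall] with w h1 h2
    simp only [h2] at h1
    refine tendsto_nhds_unique ?_ h1
    exact ((hF w).comp hns.tendsto_atTop).mul_const _
  have hFL : MemLp (weighted F) 2 volume := (memLp_congr_ae hFG).2 (Lp.memLp G)
  let F' : FockSpace := mk F hFd ((memLp_weighted_iff hFd.continuous).1 hFL)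
  have hTF : T F' = G := by
    refine Lp.ext ?_
    exact (memLp_weighted F').coeFn_toLp.trans hFG
  refine ⟨F', ?_⟩
  rw [← hTF, tendsto_iff_dist_tendsto_zero] at hG
  rw [tendsto_iff_dist_tendsto_zero]
  have h := hG.const_mul (√Real.pi)⁻¹
  rw [mul_zero] at h
  refine h.congr fun n => ?_
  rw [hTd, inv_mul_cancel_left₀ (by positivity)]

end FockSpace

section TraceClass

universe u

variable {H : Type u} [NormedAddCommGroup H] [InnerProductSpace ℂ H] [CompleteSpace H]

/-- `A` is of trace class: `∑ ⟨√(A†A) v_k, v_k⟩ < ∞` for every orthonormal (Hilbert) basis `v`.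
Every Hilbert space `H : Type u` has such a basis, indexed by a type in the same universe. -/
def IsTraceClass (A : H →L[ℂ] H) : Prop :=
  ∀ (ι : Type u) (v : HilbertBasis ι ℂ H),
    Summable fun k => (inner ℂ (v k) (CFC.sqrt (ContinuousLinearMap.adjoint A * A) (v k))).re

/-- `Tr A = t`: for every orthonormal (Hilbert) basis `v`, the series `∑ ⟨A v_k, v_k⟩` converges
to `t` (`⟨x, y⟩` being linear in `x` is Mathlib's `inner ℂ y x`). -/
def HasTrace (A : H →L[ℂ] H) (t : ℂ) : Prop :=
  ∀ (ι : Type u) (v : HilbertBasis ι ℂ H), HasSum (fun k => inner ℂ (v k) (A (v k))) t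

end TraceClass

/-- The matrix with rows `(1, a, b)`, `(0, c, d)`, `(0, 0, 1)`. -/
def flatMatrix (a b c d : ℂ) : Matrix (Fin 3) (Fin 3) ℂ := !![1, a, b; 0, c, d; 0, 0, 1]

theorem flatMatrix_mul (a b c d a' b' c' d' : ℂ) :
    flatMatrix a b c d * flatMatrix a' b' c' d' =
      flatMatrix (a' + a * c') (b' + a * d' + b) (c * c') (c * d' + d) := by
  simp [flatMatrix, add_assoc]

/-- The semigroup of all matrices `flatMatrix a b c d` with `c ≠ 0` and determinant of absolute
value `< 1`. -/
def GammaFlat : Subsemigroup (Matrix (Fin 3) (Fin 3) ℂ) where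
  carrier := {γ | (∃ a b c d : ℂ, c ≠ 0 ∧ γ = flatMatrix a b c d) ∧ ‖γ.det‖ < 1}
  mul_mem' := by
    rintro _ _ ⟨⟨a, b, c, d, hc, rfl⟩, h⟩ ⟨⟨a', b', c', d', hc', rfl⟩, h'⟩
    refine ⟨⟨_, _, _, _, mul_ne_zero hc hc', flatMatrix_mul a b c d a' b' c' d'⟩, ?_⟩
    rw [Matrix.det_mul, norm_mul]
    exact mul_lt_one_of_nonneg_of_lt_one_left (norm_nonneg _) h h'.le

/-- For `γ = flatMatrix a b c d` this is `(τ(γ) f)(w) = e^{dw - b} f(cw - a)`. -/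
def tauFlat (γ : Matrix (Fin 3) (Fin 3) ℂ) (f : ℂ → ℂ) (w : ℂ) : ℂ :=
  Complex.exp (γ 1 2 * w - γ 0 2) * f (γ 1 1 * w - γ 0 1)

end

/-! Since `c ≠ 1`, the map `w ↦ c w - a` has a fixed point `z = -a / (1 - c)`, around which it is
multiplication by `c`. Expanding `f` in its Taylor series at `z` gives `e^{dw-b} f(cw-a) = ∑ φₙ(f)
xₙ(w)`, where `φₙ` is the `n`-th Taylor coefficient at `z` and `xₙ(w) = cⁿ (w-z)ⁿ e^{dw-b}`.

The main point is `∑ ‖φₙ‖ ‖xₙ‖ < ∞` (`summable_norm_taylorCoeff_mul_norm_monomial`): Cauchy's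
estimate on a circle of radius about `√n` bounds `‖φₙ‖²` by roughly `(e/n)ⁿ`, a Gaussian integral
bounds `‖xₙ‖²` by roughly `(|c| n/e)ⁿ`, and `|c| < 1` makes the product decay geometrically. The
series then converges in operator norm, so boundedness comes for free.

A nuclear operator has trace `∑ φₙ(xₙ)` in every orthonormal basis, by exchanging two sums
(`hasTrace_of_nuclear`). Its absolute value is nuclear as well, hence the trace class property. Here
`φₙ(xₙ) = cⁿ e^{dz-b}`, and the trace is a geometric series. -/

/-! ### Nuclear operators on a Hilbert space -/

section Nuclear

universe u

variable {H : Type u} [NormedAddCommGroup H] [InnerProductSpace ℂ H] [CompleteSpace H]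

/-- An operator with the same norms as `A` factors through `A`. -/
theorem exists_comp_eq_of_norm_eq (A B : H →L[ℂ] H) (h : ∀ x, ‖B x‖ = ‖A x‖) :
    ∃ W : H →L[ℂ] H, ∀ x, W (A x) = B x := by
  let K : Submodule ℂ H := (LinearMap.range (A : H →ₗ[ℂ] H)).topologicalClosure
  have hmem : ∀ x, A x ∈ K := fun x =>
    Submodule.le_topologicalClosure _ (LinearMap.mem_range_self (A : H →ₗ[ℂ] H) x)
  let e : H →ₗ[ℂ] K := (A : H →ₗ[ℂ] H).codRestrict K hmem
  have hK : IsClosed (K : Set H) := Submodule.isClosed_topologicalClosure _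
  have : CompleteSpace K := hK.completeSpace_coe
  have hdense : DenseRange e := by
    intro y
    rw [Topology.IsInducing.subtypeVal.closure_eq_preimage_closure_image, Set.mem_preimage]
    have hy : (y : H) ∈ closure (Set.range A) := y.2
    convert! hy
    rw [← Set.range_comp]
    rfl
  -- `A x ↦ B x` is well defined and isometric on the range of `A`; it extends to the closure `K`,
  -- and by zero to the orthogonal complement.
  refine ⟨((B : H →ₗ[ℂ] H).extendOfNorm e).comp K.orthogonalProjectionOnto, fun x => ?_⟩
  have hp : K.orthogonalProjectionOnto (A x) = e x :=
    Submodule.orthogonalProjectionOnto_mem_subspace_eq_self (K := K) (e x)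
  rw [ContinuousLinearMap.comp_apply, hp,
    LinearMap.extendOfNorm_eq hdense ⟨1, fun z => by rw [one_mul]; exact (h z).le⟩]
  rfl

theorem norm_sqrt_adjoint_mul_self_apply (A : H →L[ℂ] H) (x : H) :
    ‖CFC.sqrt (ContinuousLinearMap.adjoint A * A) x‖ = ‖A x‖ := by
  have hpos : 0 ≤ ContinuousLinearMap.adjoint A * A := by
    rw [← ContinuousLinearMap.star_eq_adjoint]
    exact star_mul_self_nonneg A
  have hs : IsSelfAdjoint (CFC.sqrt (ContinuousLinearMap.adjoint A * A)) :=
    (CFC.sqrt_nonneg _).isSelfAdjoint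
  have h := CFC.sqrt_mul_sqrt_self _ hpos
  set S := CFC.sqrt (ContinuousLinearMap.adjoint A * A)
  have h1 : ‖S x‖ ^ 2 = ‖A x‖ ^ 2 := by
    rw [← inner_self_eq_norm_sq (𝕜 := ℂ), ← inner_self_eq_norm_sq (𝕜 := ℂ),
      ← ContinuousLinearMap.adjoint_inner_right S, hs.adjoint_eq,
      ← ContinuousLinearMap.adjoint_inner_right A]
    congr 2
    exact DFunLike.congr_fun h x
  exact (sq_eq_sq₀ (norm_nonneg _) (norm_nonneg _)).1 h1

/-- Cauchy–Schwarz, then Bessel's inequality for `x` and for the Riesz representative of `φ`. It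
provides the absolute convergence needed to exchange sums. -/
theorem HilbertBasis.sum_norm_apply_mul_norm_inner_le {ι : Type*} (v : HilbertBasis ι ℂ H)
    (φ : H →L[ℂ] ℂ) (x : H) (s : Finset ι) :
    ∑ k ∈ s, ‖φ (v k)‖ * ‖inner ℂ (v k) x‖ ≤ ‖φ‖ * ‖x‖ := by
  set y := (InnerProductSpace.toDual ℂ H).symm φ
  have hy : ∀ z, φ z = inner ℂ y z := fun z => (InnerProductSpace.toDual_symm_apply).symm
  have hn : ‖φ‖ = ‖y‖ := (LinearIsometryEquiv.norm_map _ φ).symm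
  refine (Real.sum_mul_le_sqrt_mul_sqrt s _ _).trans ?_
  rw [hn]
  gcongr
  · rw [Real.sqrt_le_left (norm_nonneg _)]
    simp only [hy, norm_inner_symm y]
    exact v.orthonormal.sum_inner_products_le y
  · rw [Real.sqrt_le_left (norm_nonneg _)]
    exact v.orthonormal.sum_inner_products_le x

/-- The trace of a nuclear operator. -/
theorem hasTrace_of_nuclear {A : H →L[ℂ] H} {φ : ℕ → H →L[ℂ] ℂ} {x : ℕ → H}
    (hs : Summable fun n => ‖φ n‖ * ‖x n‖) (hA : ∀ f, HasSum (fun n => φ n f • x n) (A f)) :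
    HasTrace A (∑' n, φ n (x n)) := by
  intro ι v
  have hrow : ∀ n, HasSum (fun k => φ n (v k) * inner ℂ (v k) (x n)) (φ n (x n)) := fun n => by
    have := (v.hasSum_repr (x n)).mapL (φ n)
    simpa [v.repr_apply_apply, mul_comm] using this
  have hsum : Summable fun p : ℕ × ι => φ p.1 (v p.2) * inner ℂ (v p.2) (x p.1) := by
    refine Summable.of_norm ?_
    simp only [norm_mul]
    have hsn : ∀ n, Summable fun k => ‖φ n (v k)‖ * ‖inner ℂ (v k) (x n)‖ := fun n =>
      summable_of_sum_le (fun k => by positivity) (v.sum_norm_apply_mul_norm_inner_le (φ n) (x n))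
    refine (summable_prod_of_nonneg fun p => by positivity).2 ⟨hsn, ?_⟩
    exact hs.of_nonneg_of_le (fun n => tsum_nonneg fun k => by positivity)
      fun n => (hsn n).tsum_le_of_sum_le (v.sum_norm_apply_mul_norm_inner_le (φ n) (x n))
  have htot := hsum.hasSum
  have hval := (htot.prod_fiberwise hrow).tsum_eq
  rw [hval]
  -- The same double series, now summed over `n` within each fixed `k`.
  refine ((Equiv.prodComm ι ℕ).hasSum_iff.2 htot).prod_fiberwise fun k => ?_
  have := (hA (v k)).mapL (innerSL ℂ (v k))
  simpa [inner_smul_right] using this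

/-- `√(A†A) = W A` with `W` bounded, so replacing `x n` by `W (x n)` gives a nuclear expansion of
`√(A†A)`, whose trace therefore converges. -/
theorem isTraceClass_of_nuclear {A : H →L[ℂ] H} {φ : ℕ → H →L[ℂ] ℂ} {x : ℕ → H}
    (hs : Summable fun n => ‖φ n‖ * ‖x n‖) (hA : ∀ f, HasSum (fun n => φ n f • x n) (A f)) :
    IsTraceClass A := by
  intro ι v
  obtain ⟨W, hW⟩ := exists_comp_eq_of_norm_eq A _ (norm_sqrt_adjoint_mul_self_apply A)
  have hs' : Summable fun n => ‖φ n‖ * ‖W (x n)‖ := by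
    refine (hs.mul_left ‖W‖).of_nonneg_of_le (fun n => by positivity) fun n => ?_
    rw [mul_left_comm]
    gcongr
    exact W.le_opNorm _
  have h := hasTrace_of_nuclear (A := CFC.sqrt (ContinuousLinearMap.adjoint A * A)) hs'
    (fun f => by simpa [hW] using (hA f).mapL W) ι v
  exact (Complex.hasSum_re h).summable

/-- A nuclear series converges to a bounded operator. -/
theorem exists_hasSum_nuclear {φ : ℕ → H →L[ℂ] ℂ} {x : ℕ → H}
    (hs : Summable fun n => ‖φ n‖ * ‖x n‖) :
    ∃ A : H →L[ℂ] H, ∀ f, HasSum (fun n => φ n f • x n) (A f) := by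
  have : Summable fun n => (φ n).smulRight (x n) :=
    Summable.of_norm (by simpa [ContinuousLinearMap.norm_smulRight_apply] using hs)
  exact ⟨_, fun f => by simpa using this.hasSum.mapL (ContinuousLinearMap.apply ℂ H f)⟩

end Nuclear

/-! ### Derivatives at a zero and Gaussian estimates -/

namespace Fock

/-- One differentiation lowers the order of the zero by one and changes the cofactor to `(n + 1) h +
(w - z) h'`, so the induction must range over all `h`. -/
theorem iteratedDeriv_pow_sub_mul (z : ℂ) (n : ℕ) {h : ℂ → ℂ} (hh : Differentiable ℂ h) :
    iteratedDeriv n (fun w => (w - z) ^ n * h w) z = n.factorial * h z := by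
  induction n generalizing h with
  | zero => simp
  | succ n ih =>
    have hd : deriv (fun w => (w - z) ^ (n + 1) * h w) =
        fun w => (w - z) ^ n * ((n + 1) * h w + (w - z) * deriv h w) := by
      funext w
      have h1 : HasDerivAt (fun w => (w - z) ^ (n + 1)) ((n + 1 : ℕ) * (w - z) ^ n * 1) w :=
        ((hasDerivAt_id w).sub_const z).pow (n + 1)
      refine (h1.mul (hh w).hasDerivAt).deriv.trans ?_
      push_cast
      ring
    have hh' : Differentiable ℂ (deriv h) :=
      hh.contDiff.differentiable_deriv_two
    rw [iteratedDeriv_succ', hd, ih (by fun_prop), Nat.factorial_succ]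
    push_cast
    ring

theorem integrable_exp_neg_mul_sq_norm {r : ℝ} (hr : 0 < r) :
    Integrable fun w : ℂ => Real.exp (-r * ‖w‖ ^ 2) := by
  have h := (GaussianFourier.integrable_cexp_neg_mul_sq_norm_add (V := ℂ) (b := (r : ℂ))
    (by simpa using hr) 0 0).norm
  refine h.congr (ae_of_all _ fun w => ?_)
  simp only [Complex.norm_exp]
  congr 1
  simp [← Complex.ofReal_pow, ← Complex.ofReal_neg, ← Complex.ofReal_mul]

theorem norm_cexp_affine_sq_le (b d w : ℂ) :
    ‖Complex.exp (d * w - b)‖ ^ 2 ≤ Real.exp (2 * (‖d‖ * ‖w‖ + ‖b‖)) := by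
  rw [Complex.norm_exp, ← Real.exp_nat_mul, Real.exp_le_exp]
  have h1 := (Complex.re_le_norm (d * w - b)).trans (norm_sub_le _ _)
  rw [norm_mul] at h1
  push_cast
  linarith

theorem integrable_majorant {q : ℝ} (hq : 0 < q) (hq1 : q < 1) (b d z : ℂ) :
    Integrable fun w : ℂ => ‖Complex.exp (d * w - b)‖ ^ 2 * Real.exp (q * ‖w - z‖ ^ 2) *
      Real.exp (-‖w‖ ^ 2) := by
  -- The exponent is at most `2A‖w‖ - (1-q)‖w‖²` plus a constant. Completing the square absorbs the
  -- linear term into half of the quadratic one.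
  set A := ‖d‖ + q * ‖z‖
  set B := 2 * A ^ 2 / (1 - q) + q * ‖z‖ ^ 2 + 2 * ‖b‖
  have hq' : 0 < 1 - q := by linarith
  refine ((integrable_exp_neg_mul_sq_norm (half_pos hq')).const_mul (Real.exp B)).mono'
    (Continuous.aestronglyMeasurable (by fun_prop)) (ae_of_all _ fun w => ?_)
  rw [Real.norm_of_nonneg (by positivity), ← Real.exp_add]
  refine (mul_le_mul_of_nonneg_right (mul_le_mul_of_nonneg_right (norm_cexp_affine_sq_le b d w)
    (Real.exp_nonneg _)) (Real.exp_nonneg _)).trans ?_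
  rw [← Real.exp_add, ← Real.exp_add, Real.exp_le_exp]
  have h1 : ‖w - z‖ ^ 2 ≤ (‖w‖ + ‖z‖) ^ 2 := by
    gcongr
    exact norm_sub_le _ _
  have h2 := mul_le_mul_of_nonneg_left h1 hq.le
  have h3 : 2 * A * ‖w‖ ≤ 2 * A ^ 2 / (1 - q) + (1 - q) / 2 * ‖w‖ ^ 2 := by
    have : 0 ≤ ((1 - q) * ‖w‖ - 2 * A) ^ 2 / (2 * (1 - q)) := by positivity
    have e : ((1 - q) * ‖w‖ - 2 * A) ^ 2 / (2 * (1 - q)) =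
        2 * A ^ 2 / (1 - q) + (1 - q) / 2 * ‖w‖ ^ 2 - 2 * A * ‖w‖ := by
      field_simp
      ring
    linarith
  simp only [A, B] at h3 ⊢
  linarith

/-- The `n`-th power of `s ≤ e^{s-1}` at `s = q t / (n + 1)`. The maximum of `tⁿ e^{-qt}` is at `t =
n / q`; using `n + 1` avoids a separate case `n = 0`. -/
theorem pow_le_mul_exp {q t : ℝ} (hq : 0 < q) (ht : 0 ≤ t) (n : ℕ) :
    t ^ n ≤ ((n + 1) / q * Real.exp (-1)) ^ n * Real.exp (q * t) := by
  have hn : (0 : ℝ) < n + 1 := by positivity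
  have h1 : q * t / (n + 1) ≤ Real.exp (q * t / (n + 1) - 1) := by
    linarith [Real.add_one_le_exp (q * t / (n + 1) - 1)]
  have h2 := pow_le_pow_left₀ (by positivity) h1 n
  rw [← Real.exp_nat_mul] at h2
  have h3 : (n : ℝ) * (q * t / (n + 1) - 1) ≤ n * (-1) + q * t := by
    have : (n : ℝ) * (q * t / (n + 1)) ≤ q * t := by
      rw [mul_div_assoc', div_le_iff₀ hn]
      nlinarith [mul_nonneg hq.le ht]
    linarith
  have h4 := h2.trans (Real.exp_le_exp.2 h3)
  rw [Real.exp_add, Real.exp_nat_mul] at h4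
  calc t ^ n = ((n + 1) / q) ^ n * (q * t / (n + 1)) ^ n := by
        rw [← mul_pow]
        congr 1
        field_simp
    _ ≤ ((n + 1) / q) ^ n * (Real.exp (-1) ^ n * Real.exp (q * t)) := by gcongr
    _ = _ := by rw [mul_pow, mul_assoc]

/-- The choice `q = ‖c‖` keeps the majorant integrable, as `‖c‖ < 1`, and leaves one of the two
factors `‖c‖` per degree as a source of decay. -/
theorem norm_monomial_sq_le {c : ℂ} (hc : c ≠ 0) (b d z : ℂ) (n : ℕ) (w : ℂ) :
    ‖c ^ n * ((w - z) ^ n * Complex.exp (d * w - b))‖ ^ 2 * Real.exp (-‖w‖ ^ 2) ≤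
      (‖c‖ * (n + 1) * Real.exp (-1)) ^ n * (‖Complex.exp (d * w - b)‖ ^ 2 *
        Real.exp (‖c‖ * ‖w - z‖ ^ 2) * Real.exp (-‖w‖ ^ 2)) := by
  have hq : 0 < ‖c‖ := norm_pos_iff.2 hc
  have h := pow_le_mul_exp hq (sq_nonneg ‖w - z‖) n
  rw [norm_mul, norm_mul, norm_pow, norm_pow]
  calc _ = (‖c‖ ^ 2) ^ n * (‖w - z‖ ^ 2) ^ n *
        (‖Complex.exp (d * w - b)‖ ^ 2 * Real.exp (-‖w‖ ^ 2)) := by ring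
    _ ≤ (‖c‖ ^ 2) ^ n * (((n + 1) / ‖c‖ * Real.exp (-1)) ^ n * Real.exp (‖c‖ * ‖w - z‖ ^ 2)) *
        (‖Complex.exp (d * w - b)‖ ^ 2 * Real.exp (-‖w‖ ^ 2)) := by gcongr
    _ = (‖c‖ ^ 2 * ((n + 1) / ‖c‖ * Real.exp (-1))) ^ n * (‖Complex.exp (d * w - b)‖ ^ 2 *
        Real.exp (‖c‖ * ‖w - z‖ ^ 2) * Real.exp (-‖w‖ ^ 2)) := by rw [mul_pow (‖c‖ ^ 2)]; ring
    _ = _ := by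
        congr 2
        field_simp

end Fock

/-! ### Taylor coefficients, monomials and the nuclear bound -/

namespace FockSpace

/-- The `n`-th Taylor coefficient at `z`. -/
noncomputable def taylorCoeffₗ (z : ℂ) (n : ℕ) : FockSpace →ₗ[ℂ] ℂ where
  toFun f := (n.factorial : ℂ)⁻¹ * iteratedDeriv n f z
  map_add' f g := by
    rw [← mul_add, ← iteratedDeriv_add f.differentiable.contDiff.contDiffAt
      g.differentiable.contDiff.contDiffAt]
    rfl
  map_smul' s f := by
    simp only [RingHom.id_apply, smul_eq_mul]
    rw [mul_left_comm, ← smul_eq_mul s, ← iteratedDeriv_const_smul_field]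
    rfl

/-- Cauchy's estimate on the circle of radius `R`, combined with the growth bound for point
evaluations. `R` stays free so that it can depend on `n`. -/
theorem norm_taylorCoeffₗ_le (z : ℂ) (n : ℕ) {R : ℝ} (hR : 0 < R) (f : FockSpace) :
    ‖taylorCoeffₗ z n f‖ ≤ Real.exp ((R + (‖z‖ + 1)) ^ 2 / 2) / R ^ n * ‖f‖ := by
  have hn : (0 : ℝ) < n.factorial := by positivity
  have h := Complex.norm_iteratedDeriv_le_of_forall_mem_sphere_norm_le (c := z) (R := R)
    (C := Real.exp ((R + (‖z‖ + 1)) ^ 2 / 2) * ‖f‖) (f := f) n hR f.differentiable.diffContOnCl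
    fun w hw => by
      refine (norm_apply_le f w).trans ?_
      have h1 : ‖w‖ ≤ R + ‖z‖ := by
        have := norm_add_le (w - z) z
        rw [mem_sphere_iff_norm.1 hw, sub_add_cancel] at this
        exact this
      have h2 : ‖w‖ + 1 ≤ R + (‖z‖ + 1) := by linarith
      gcongr
  change ‖(n.factorial : ℂ)⁻¹ * iteratedDeriv n f z‖ ≤ _
  rw [norm_mul, norm_inv, Complex.norm_natCast, inv_mul_le_iff₀ hn]
  refine h.trans_eq ?_
  ring

/-- The `n`-th Taylor coefficient at `z`, as a bounded functional. -/
noncomputable def taylorCoeff (z : ℂ) (n : ℕ) : FockSpace →L[ℂ] ℂ :=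
  (taylorCoeffₗ z n).mkContinuous _ (norm_taylorCoeffₗ_le z n one_pos)

theorem taylorCoeff_apply (z : ℂ) (n : ℕ) (f : FockSpace) :
    taylorCoeff z n f = (n.factorial : ℂ)⁻¹ * iteratedDeriv n f z := rfl

theorem norm_taylorCoeff_le (z : ℂ) (n : ℕ) {R : ℝ} (hR : 0 < R) :
    ‖taylorCoeff z n‖ ≤ Real.exp ((R + (‖z‖ + 1)) ^ 2 / 2) / R ^ n :=
  (taylorCoeff z n).opNorm_le_bound (by positivity) (norm_taylorCoeffₗ_le z n hR)

theorem hasSum_taylorCoeff (f : FockSpace) (z w : ℂ) :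
    HasSum (fun n => taylorCoeff z n f * (w - z) ^ n) (f w) := by
  convert! Complex.hasSum_taylorSeries_of_entire f.differentiable z w using 2 with n
  rw [taylorCoeff_apply, smul_eq_mul, smul_eq_mul]
  ring

/-- Point evaluation as a bounded functional. -/
noncomputable def eval (z : ℂ) : FockSpace →L[ℂ] ℂ :=
  LinearMap.mkContinuous ⟨⟨fun f => f z, fun _ _ => rfl⟩, fun _ _ => rfl⟩ _
    fun f => norm_apply_le f z

@[simp] theorem eval_apply (z : ℂ) (f : FockSpace) : eval z f = f z := rfl

variable {c : ℂ} (hc : c ≠ 0) (hc1 : ‖c‖ < 1) (b d z : ℂ)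

/-- `w ↦ cⁿ (w - z)ⁿ e^{dw - b}`. -/
noncomputable def monomial (n : ℕ) : FockSpace :=
  mk (fun w => c ^ n * ((w - z) ^ n * Complex.exp (d * w - b))) (by fun_prop) <|
    ((Fock.integrable_majorant (norm_pos_iff.2 hc) hc1 b d z).const_mul
      ((‖c‖ * (n + 1) * Real.exp (-1)) ^ n)).mono'
      (Continuous.aestronglyMeasurable (by fun_prop)) (ae_of_all _ fun w => by
        rw [Real.norm_of_nonneg (by positivity)]
        exact Fock.norm_monomial_sq_le hc b d z n w)

theorem norm_monomial_sq_le : ∃ D : ℝ, 0 ≤ D ∧ ∀ n : ℕ,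
    ‖monomial hc hc1 b d z n‖ ^ 2 ≤ D * (‖c‖ * (n + 1) * Real.exp (-1)) ^ n := by
  refine ⟨1 / Real.pi * ∫ w : ℂ, ‖Complex.exp (d * w - b)‖ ^ 2 * Real.exp (‖c‖ * ‖w - z‖ ^ 2) *
      Real.exp (-‖w‖ ^ 2), ?_, fun n => ?_⟩
  · exact mul_nonneg (by positivity) (integral_nonneg fun w => by positivity)
  · rw [norm_sq_eq, mul_assoc, ← integral_mul_const]
    refine mul_le_mul_of_nonneg_left (integral_mono (integrable _) ?_ fun w => ?_) (by positivity)
    · exact (Fock.integrable_majorant (norm_pos_iff.2 hc) hc1 b d z).mul_const _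
    · exact (Fock.norm_monomial_sq_le hc b d z n w).trans_eq (mul_comm _ _)

theorem summable_norm_taylorCoeff_mul_norm_monomial :
    Summable fun n => ‖taylorCoeff z n‖ * ‖monomial hc hc1 b d z n‖ := by
  obtain ⟨D, hD, hDn⟩ := norm_monomial_sq_le hc hc1 b d z
  have hq : 0 < ‖c‖ := norm_pos_iff.2 hc
  -- The shift by `K` in the Cauchy bound costs a factor `e^{εn}`, which the gap between `‖c‖` and
  -- `1` can absorb.
  obtain ⟨ε, hε, hqε⟩ : ∃ ε > 0, ‖c‖ * Real.exp ε < 1 := by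
    have hlog := Real.log_neg hq hc1
    refine ⟨-Real.log ‖c‖ / 2, by linarith, ?_⟩
    nth_rewrite 1 [← Real.exp_log hq]
    rw [← Real.exp_add, Real.exp_lt_one_iff]
    linarith
  set K := ‖z‖ + 1
  set C := D * Real.exp (1 + ε + (1 + ε⁻¹) * K ^ 2)
  have hgeom : Summable fun n : ℕ => √C * √(‖c‖ * Real.exp ε) ^ n :=
    (summable_geometric_of_lt_one (Real.sqrt_nonneg _)
      ((Real.sqrt_lt' one_pos).2 (by simpa using hqε))).mul_left _
  refine hgeom.of_nonneg_of_le (fun n => by positivity) fun n => ?_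
  have hn : (0 : ℝ) < n + 1 := by positivity
  have hR : 0 < √((n : ℝ) + 1) := Real.sqrt_pos.2 hn
  have hR2 : √((n : ℝ) + 1) ^ 2 = n + 1 := Real.sq_sqrt hn.le
  -- `R = √(n+1)` nearly minimises `e^{R²/2} / Rⁿ`, and makes `R^{2n} = (n+1)ⁿ` cancel exactly
  -- against the monomial bound.
  have h1 := norm_taylorCoeff_le z n hR
  set R := √((n : ℝ) + 1)
  -- The cross term is split by `2RK ≤ εR² + ε⁻¹K²`.
  have h2 : (R + K) ^ 2 ≤ n * ε + n + (1 + ε + (1 + ε⁻¹) * K ^ 2) := by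
    have : 0 ≤ ε⁻¹ * (ε * R - K) ^ 2 := by positivity
    have e : ε⁻¹ * (ε * R - K) ^ 2 = ε * R ^ 2 - 2 * R * K + ε⁻¹ * K ^ 2 := by
      field_simp
      ring
    nlinarith
  refine le_of_sq_le_sq ?_ (by positivity)
  have hsq1 : ‖taylorCoeff z n‖ ^ 2 ≤ Real.exp ((R + K) ^ 2) / ((n : ℝ) + 1) ^ n := by
    refine (pow_le_pow_left₀ (norm_nonneg (taylorCoeff z n)) h1 2).trans_eq ?_
    rw [div_pow, ← Real.exp_nat_mul, ← hR2]
    congr 1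
    · congr 1
      push_cast
      ring
    · ring
  calc (‖taylorCoeff z n‖ * ‖monomial hc hc1 b d z n‖) ^ 2
      ≤ Real.exp ((R + K) ^ 2) / ((n : ℝ) + 1) ^ n *
        (D * (‖c‖ * (n + 1) * Real.exp (-1)) ^ n) := by
        rw [mul_pow]
        exact mul_le_mul hsq1 (hDn n) (by positivity) (by positivity)
    _ = D * (‖c‖ * Real.exp (-1)) ^ n * Real.exp ((R + K) ^ 2) := by
        rw [mul_right_comm, mul_pow _ ((n : ℝ) + 1)]
        field_simp
    _ ≤ D * (‖c‖ * Real.exp (-1)) ^ n *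
        Real.exp (n * ε + n + (1 + ε + (1 + ε⁻¹) * K ^ 2)) := by gcongr
    _ = C * (‖c‖ * Real.exp ε) ^ n := by
        have e : Real.exp (-1) ^ n * Real.exp n = 1 := by
          rw [← Real.exp_nat_mul, ← Real.exp_add]
          simp
        rw [Real.exp_add, Real.exp_add (n * ε), Real.exp_nat_mul, mul_pow, mul_pow ‖c‖]
        simp only [C]
        linear_combination (D * ‖c‖ ^ n * Real.exp ε ^ n *
          Real.exp (1 + ε + (1 + ε⁻¹) * K ^ 2)) * e
    _ = (√C * √(‖c‖ * Real.exp ε) ^ n) ^ 2 := by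
        rw [mul_pow (√C), pow_right_comm, Real.sq_sqrt (by positivity), Real.sq_sqrt (by positivity)]

theorem taylorCoeff_monomial (n : ℕ) :
    taylorCoeff z n (monomial hc hc1 b d z n) = c ^ n * Complex.exp (d * z - b) := by
  have h : iteratedDeriv n (monomial hc hc1 b d z n) z =
      c ^ n * (n.factorial * Complex.exp (d * z - b)) := by
    rw [← Fock.iteratedDeriv_pow_sub_mul z n (h := fun w => Complex.exp (d * w - b))
      (by fun_prop), ← smul_eq_mul (c ^ n), ← iteratedDeriv_fun_const_smul_field]
    rfl
  rw [taylorCoeff_apply, h, mul_left_comm, inv_mul_cancel_left₀ (by exact_mod_cast n.factorial_ne_zero)]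

end FockSpace

/-! ### The operator and its trace -/

theorem mainTheorem10 (a b c d : ℂ) (hγ : flatMatrix a b c d ∈ GammaFlat) :
    ∃ T : FockSpace →L[ℂ] FockSpace,
      (∀ (f : FockSpace) (w : ℂ), T f w = tauFlat (flatMatrix a b c d) f w) ∧
      IsTraceClass T ∧
      HasTrace T (Complex.exp (-((a * d + b * (1 - c)) / (1 - c))) / (1 - c)) := by
  have hdet : (flatMatrix a b c d).det = c := by simp [flatMatrix, Matrix.det_fin_three]
  have hc : c ≠ 0 := by
    obtain ⟨⟨a', b', c', d', hc', h⟩, -⟩ := hγ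
    have : c = c' := by simpa [flatMatrix] using congrFun₂ h 1 1
    rwa [this]
  have hc1 : ‖c‖ < 1 := by simpa only [hdet] using hγ.2
  have h1c : 1 - c ≠ 0 := by
    intro h
    rw [← sub_eq_zero.1 h] at hc1
    simp at hc1
  -- The fixed point of `w ↦ c w - a`.
  set z := -a / (1 - c)
  have hs := FockSpace.summable_norm_taylorCoeff_mul_norm_monomial hc hc1 b d z
  obtain ⟨T, hT⟩ := exists_hasSum_nuclear hs
  refine ⟨T, fun f w => ?_, isTraceClass_of_nuclear hs hT, ?_⟩
  · have h1 := (hT f).mapL (FockSpace.eval w)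
    have hz : c * w - a - z = c * (w - z) := by
      simp only [z]
      field_simp
      ring
    have h2 := (FockSpace.hasSum_taylorCoeff f z (c * w - a)).mul_left (Complex.exp (d * w - b))
    have h3 : tauFlat (flatMatrix a b c d) f w = Complex.exp (d * w - b) * f (c * w - a) := by
      simp [tauFlat, flatMatrix]
    rw [h3]
    -- Norm convergence implies pointwise convergence, and at `w` the nuclear series is the Taylor
    -- series of `f` at `c w - a` times the exponential.
    refine HasSum.unique h1 (h2.congr_fun fun n => ?_)
    rw [hz, FockSpace.eval_apply, FockSpace.smul_apply, FockSpace.monomial, FockSpace.mk_apply, mul_pow]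
    ring
  · convert! hasTrace_of_nuclear hs hT using 1
    simp only [FockSpace.taylorCoeff_monomial]
    rw [tsum_mul_right, tsum_geometric_of_norm_lt_one hc1, div_eq_inv_mul]
    congr 2
    simp only [z]
    field_simp
    ring
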